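/- Let $V_n$ be the vector space of skew-symmetric bilinear maps $\mu:\mathbb{R}^n\times\mathbb{R}^n\to\mathbb{R}^n$ and let $\mathcal{N}_n\subset V_n$ be the variety of nilpotent Lie brackets, i.e. those $\mu\in V_n$ that satisfy the Jacobi identity and for which every $\mathrm{ad}_\mu x=\mu(x,\cdot)$ is nilpotent. For $\mu\in\mathcal{N}_n$ let $x\cdot_\mu y=x+y+p_\mu(x,y)$ be the product on $\mathbb{R}^n$ given by the (finite) Baker–Campbell–Hausdorff series of $\mu$, let $L_\mu(x)y=x\cdot_\mu y$, and let $g_\mu$ be the Riemannian metric on $\mathbb{R}^n$ determined by $$g_\mu(x)\big(dL_\mu(x)|_0v,\;dL_\mu(x)|_0w\big)=\langle v,w\rangle,\qquad x,v,w\in\mathbb{R}^n,$$ where $\langle\cdot,\cdot\rangle$ is the canonical inner product. For Riemannian metrics $g_k$, $g$ on $\mathbb{R}^n$, we say that $g_k\to g$ in $C^\infty$ uniformly on compact sets if for all compact $K\subset\mathbb{R}^n$, all integers $p>0$ and all $\varepsilon>0$ there is $k_0$ such that for all $k\ge k_0$ $$\sup_{0\le q\le p}\ \sup_{x\in K}\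 \|\nabla^q(g_k-g)\|_g<\varepsilon ,$$ where $\nabla$ is the Levi-Civita connection of $g$ and $\|\cdot\|_g$ is the norm induced by $g$ on tensors. Then, for every sequence $(\mu_k)$ in $\mathcal{N}_n$ and every $\lambda\in\mathcal{N}_n$, the following are equivalent: 1. $\mu_k\to\lambda$ in the vector space topology of $V_n$; 2. $g_{\mu_k}\to g_\lambda$ in $C^\infty$ uniformly on compact sets; 3. the condition in the above definition holds for $g_{\mu_k}$, $g_\lambda$ with the supremum taken over $1\le q\le p$ only; 4. $g_{\mu_k}\to g_\lambda$ in the compact-open $C^\infty$ topology on the space $\mathcal{M}_n$ of Riemannian metrics on $\mathbb{R}^n$ (uniform convergence on compact sets of the coordinates of the metric and of all their partial derivatives). Moreover, $\mathcal{N}_n\to\mathcal{M}_n$, $\mu\mapsto g_\mu$, is a topological embedding, where $\mathcal{N}_n$ carries the topology induced from $V_n$ and $\mathcal{M}_n$ the compact-open $C^\infty$ topology. -/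

import Mathlib

open Filter Topology
open scoped ContDiff InnerProductSpace UniformConvergence

noncomputable section

namespace Nilmanifold

/-- `ℝⁿ` with its canonical inner product. -/
abbrev E (n : ℕ) : Type := EuclideanSpace ℝ (Fin n)

/-- Bilinear maps `ℝⁿ × ℝⁿ → ℝⁿ`, with the usual topology of this finite-dimensional space. -/
abbrev Bilin (n : ℕ) : Type := E n →L[ℝ] E n →L[ℝ] E n

/-- The vector space `V_n` of skew-symmetric bilinear maps. -/
def skewBilin (n : ℕ) : Submodule ℝ (Bilin n) where
  carrier := {μ | ∀ x y, μ x y = -μ y x}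
  add_mem' := by
    intro a b ha hb x y
    simp only [add_apply, ha x y, hb x y]
    abel
  zero_mem' := by intro x y; simp
  smul_mem' := by
    intro c a ha x y
    simp only [smul_apply, ha x y, smul_neg]

/-- Jacobi identity: every `ad x = μ x` is a derivation of the algebra `(ℝⁿ, μ)`. -/
def Jacobi {n : ℕ} (μ : Bilin n) : Prop :=
  ∀ x y z, μ x (μ y z) = μ (μ x y) z + μ y (μ x z)

/-- The variety of nilpotent Lie brackets on `ℝⁿ`, a subset of the vector space `V_n`. -/
def nilVariety (n : ℕ) : Set (skewBilin n) :=
  {μ | Jacobi μ.1 ∧ ∀ x, IsNilpotent (μ.1 x)}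

/-! ### The group operation -/

/-- Right-nested bracket `μ(a₁, μ(a₂, … μ(a_{l-1}, a_l)))` of a list of vectors. -/
def nested {n : ℕ} (μ : Bilin n) : List (E n) → E n
  | [] => 0
  | [a] => a
  | a :: b :: l => μ a (nested μ (b :: l))

/-- The list `x^{r₁} y^{s₁} ⋯ x^{r_m} y^{s_m}` with `ρ i = (r_i, s_i)`. -/
def dynkinWord {n m d : ℕ} (x y : E n) (ρ : Fin m → Fin (d + 1) × Fin (d + 1)) : List (E n) :=
  (List.ofFn fun i =>
    List.replicate ((ρ i).1 : ℕ) x ++ List.replicate ((ρ i).2 : ℕ) y).flatten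

/-- Homogeneous component of degree `d` of the Baker-Campbell-Hausdorff series
`log (exp x exp y)`, in Dynkin's form
`∑_m (-1)^(m-1)/m ∑ [x^{r₁} y^{s₁} ⋯ x^{r_m} y^{s_m}] / (d ∏ r_i! s_i!)`,
the inner sum being over all `r, s` with `r_i + s_i > 0` and `∑ (r_i + s_i) = d`. -/
def bchTerm {n : ℕ} (μ : Bilin n) (d : ℕ) (x y : E n) : E n :=
  ∑ m ∈ Finset.Icc 1 d,
    ∑ ρ : Fin m → Fin (d + 1) × Fin (d + 1) with
        (∀ i, 0 < ((ρ i).1 : ℕ) + ((ρ i).2 : ℕ)) ∧ ∑ i, (((ρ i).1 : ℕ) + ((ρ i).2 : ℕ)) = d,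
      ((-1 : ℝ) ^ (m - 1) / m /
          (d * ∏ i, (((ρ i).1 : ℕ).factorial * ((ρ i).2 : ℕ).factorial : ℝ))) •
        nested μ (dynkinWord x y ρ)

/-- The product `x ·_μ y = x + y + p_μ(x, y)` given by the Baker-Campbell-Hausdorff formula. For a
nilpotent Lie bracket on `ℝⁿ` every iterated bracket of more than `n` vectors vanishes, so the
series stops at degree `n`. The term of degree one is `x + y`. -/
def bchMul {n : ℕ} (μ : Bilin n) (x y : E n) : E n :=
  ∑ d ∈ Finset.Icc 1 n, bchTerm μ d x y

/-- The differential at `0` of the left translation `y ↦ x ·_μ y`. -/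
def dL {n : ℕ} (μ : Bilin n) (x : E n) : E n →L[ℝ] E n :=
  fderiv ℝ (fun y => bchMul μ x y) 0

/-! ### `dL` is invertible and depends smoothly on the point -/

/-- `nested` along a word in two letters. -/
def nestedW {n : ℕ} (μ : Bilin n) (x y : E n) (w : List Bool) : E n :=
  nested μ (w.map fun b => cond b x y)

theorem dynkinWord_eq {n m d : ℕ} (ρ : Fin m → Fin (d + 1) × Fin (d + 1)) :
    ∃ w : List Bool, w.length = ∑ i, (((ρ i).1 : ℕ) + ((ρ i).2 : ℕ)) ∧
      ∀ x y : E n, dynkinWord x y ρ = w.map fun b => cond b x y := by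
  refine ⟨(List.ofFn fun i =>
    List.replicate ((ρ i).1 : ℕ) true ++ List.replicate ((ρ i).2 : ℕ) false).flatten, ?_, ?_⟩
  · simp [List.length_flatten, List.map_ofFn, List.sum_ofFn]
  · intro x y
    simp [dynkinWord, List.map_flatten, List.map_ofFn, Function.comp_def]

theorem contDiff_nestedW {n : ℕ} (μ : Bilin n) (w : List Bool) :
    ContDiff ℝ ∞ fun p : E n × E n => nestedW μ p.1 p.2 w := by
  induction w with
  | nil => exact contDiff_const
  | cons b w ih =>
    have hb : ContDiff ℝ ∞ fun p : E n × E n => cond b p.1 p.2 := by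
      cases b
      · exact contDiff_snd
      · exact contDiff_fst
    cases w with
    | nil => exact hb
    | cons c w => exact (μ.contDiff.comp hb).clm_apply ih

theorem contDiff_bchMul {n : ℕ} (μ : Bilin n) :
    ContDiff ℝ ∞ fun p : E n × E n => bchMul μ p.1 p.2 := by
  unfold bchMul bchTerm
  refine ContDiff.sum fun d _ => ContDiff.sum fun m _ => ContDiff.sum fun ρ _ => ?_
  apply ContDiff.const_smul
  obtain ⟨w, -, hw⟩ := dynkinWord_eq (n := n) ρ
  simp only [hw]
  exact contDiff_nestedW μ w

theorem contDiff_dL {n : ℕ} (μ : Bilin n) : ContDiff ℝ ∞ (dL μ) := by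
  unfold dL
  exact ContDiff.fderiv (n := ∞) (contDiff_bchMul μ) contDiff_const (by simp)

/-- Operators of the form `a q` with `q` commuting with `a`. -/
def IsMulOf {R : Type*} [Ring R] (a D : R) : Prop := ∃ q, Commute a q ∧ D = a * q

theorem nestedW_zero {n : ℕ} (μ : Bilin n) (hs : ∀ x y, μ x y = -μ y x) (x : E n) :
    ∀ w : List Bool, 2 ≤ w.length → nestedW μ x 0 w = 0 := by
  have hxx : μ x x = 0 := by
    have h := hs x x
    have h2 : (2 : ℝ) • μ x x = 0 := by rw [two_smul]; nth_rewrite 1 [h]; simp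
    exact (smul_eq_zero.mp h2).resolve_left two_ne_zero
  intro w
  induction w with
  | nil => simp
  | cons b w ih =>
    intro hw
    cases w with
    | nil => simp at hw
    | cons c w =>
      cases w with
      | nil => cases b <;> cases c <;> simp [nestedW, nested, hxx]
      | cons e w =>
        have h := ih (by simp)
        have h2 : nestedW μ x 0 (b :: c :: e :: w)
          = μ (cond b x 0) (nestedW μ x 0 (c :: e :: w)) := rfl
        rw [h2, h, map_zero]

theorem hasFDerivAt_nestedW {n : ℕ} (μ : Bilin n) (hs : ∀ x y, μ x y = -μ y x) (x : E n) :
    ∀ w : List Bool, 2 ≤ w.length →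
      ∃ D : E n →L[ℝ] E n, IsMulOf (μ x) D ∧ HasFDerivAt (fun y => nestedW μ x y w) D 0 := by
  intro w
  induction w with
  | nil => simp
  | cons b w ih =>
    intro hw
    cases w with
    | nil => simp at hw
    | cons c w =>
      have h2 : (fun y => nestedW μ x y (b :: c :: w))
          = fun y => μ (cond b x y) (nestedW μ x y (c :: w)) := rfl
      rw [h2]
      have key : ∃ D : E n →L[ℝ] E n, Commute (μ x) D ∧
          HasFDerivAt (fun y => nestedW μ x y (c :: w)) D 0 := by
        cases w with
        | nil =>
          cases c
          · exact ⟨1, Commute.one_right _, hasFDerivAt_id _⟩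
          · exact ⟨0, Commute.zero_right _, hasFDerivAt_const _ _⟩
        | cons e w =>
          obtain ⟨D, ⟨q, hq, rfl⟩, hD⟩ := ih (by simp)
          exact ⟨_, (Commute.refl _).mul_right hq, hD⟩
      obtain ⟨D, hc, hD⟩ := key
      cases b
      · have hlin : HasFDerivAt (fun y : E n => μ y) μ 0 := μ.hasFDerivAt
        have h := hlin.clm_apply hD
        refine ⟨_, ?_, h⟩
        simp only [map_zero]
        cases w with
        | nil =>
          cases c
          · refine ⟨0, Commute.zero_right _, ?_⟩
            ext v i
            simp [nestedW, nested]
          · refine ⟨-1, (Commute.one_right (μ x)).neg_right (R := E n →L[ℝ] E n), ?_⟩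
            ext v i
            simp [nestedW, nested, hs v x]
        | cons e w =>
          refine ⟨0, Commute.zero_right _, ?_⟩
          rw [nestedW_zero μ hs x (c :: e :: w) (by simp)]
          ext v i
          simp
      · exact ⟨(μ x) * D, ⟨D, hc, rfl⟩, (μ x).hasFDerivAt.comp (0 : E n) hD⟩

theorem IsMulOf.sum {R ι : Type*} [Ring R] {a : R} (s : Finset ι) (D : ι → R)
    (h : ∀ i ∈ s, IsMulOf a (D i)) : IsMulOf a (∑ i ∈ s, D i) := by
  choose! q hq hD using h
  exact ⟨∑ i ∈ s, q i, Commute.sum_right _ _ _ hq, by rw [Finset.mul_sum, Finset.sum_congr rfl hD]⟩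

theorem IsMulOf.smul {R : Type*} [Ring R] [Algebra ℝ R] {a D : R} (h : IsMulOf a D) (c : ℝ) :
    IsMulOf a (c • D) := by
  obtain ⟨q, hq, rfl⟩ := h
  exact ⟨c • q, hq.smul_right c, (mul_smul_comm c a q).symm⟩

theorem hasFDerivAt_bchTerm {n : ℕ} (μ : Bilin n) (hs : ∀ x y, μ x y = -μ y x) (x : E n)
    (d : ℕ) (hd : 2 ≤ d) :
    ∃ D : E n →L[ℝ] E n, IsMulOf (μ x) D ∧ HasFDerivAt (fun y => bchTerm μ d x y) D 0 := by
  have hmain : ∀ (m : ℕ) (ρ : Fin m → Fin (d + 1) × Fin (d + 1)),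
      ∃ D : E n →L[ℝ] E n, ∑ i, (((ρ i).1 : ℕ) + ((ρ i).2 : ℕ)) = d →
        IsMulOf (μ x) D ∧ HasFDerivAt (fun y => nested μ (dynkinWord x y ρ)) D 0 := by
    intro m ρ
    by_cases h : ∑ i, (((ρ i).1 : ℕ) + ((ρ i).2 : ℕ)) = d
    · obtain ⟨w, hl, hw⟩ := dynkinWord_eq (n := n) ρ
      obtain ⟨D, h1, h2⟩ := hasFDerivAt_nestedW μ hs x w (by omega)
      refine ⟨D, fun _ => ⟨h1, ?_⟩⟩
      simp only [hw]
      exact h2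
    · exact ⟨0, fun h' => absurd h' h⟩
  choose D hD using hmain
  unfold bchTerm
  refine ⟨_, ?_, HasFDerivAt.fun_sum fun m _ => HasFDerivAt.fun_sum fun ρ hρ =>
    ((hD m ρ (Finset.mem_filter.mp hρ).2.2).2.fun_const_smul _)⟩
  refine IsMulOf.sum _ _ fun m _ => IsMulOf.sum _ _ fun ρ hρ => ?_
  exact (hD m ρ (Finset.mem_filter.mp hρ).2.2).1.smul _

theorem bchTerm_one {n : ℕ} (μ : Bilin n) (x y : E n) : bchTerm μ 1 x y = x + y := by
  have hS : (Finset.univ.filter fun ρ : Fin 1 → Fin (1 + 1) × Fin (1 + 1) =>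
      (∀ i, 0 < ((ρ i).1 : ℕ) + ((ρ i).2 : ℕ)) ∧
        ∑ i, (((ρ i).1 : ℕ) + ((ρ i).2 : ℕ)) = 1) = {fun _ => (1, 0), fun _ => (0, 1)} := by
    decide
  have hne : (fun _ => (1, 0) : Fin 1 → Fin (1 + 1) × Fin (1 + 1)) ≠ fun _ => (0, 1) := by
    decide
  unfold bchTerm
  rw [Finset.Icc_self, Finset.sum_singleton, hS, Finset.sum_pair hne]
  simp [dynkinWord, nested]

theorem isUnit_dL {n : ℕ} (μ : nilVariety n) (x : E n) : IsUnit (dL μ.1.1 x) := by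
  obtain ⟨⟨μ, hs⟩, hJ, hN⟩ := μ
  change IsUnit (dL μ x)
  rcases Nat.eq_zero_or_pos n with rfl | hn
  · rw [Subsingleton.elim (dL μ x) 1]
    exact isUnit_one
  have hsplit : ∀ y, bchMul μ x y = (x + y) + ∑ d ∈ Finset.Icc 2 n, bchTerm μ d x y := by
    intro y
    unfold bchMul
    rw [← bchTerm_one μ x y, ← Finset.add_sum_Ioc_eq_sum_Icc (by omega : 1 ≤ n)]
    rfl
  have h2 : ∀ d : ℕ, ∃ D : E n →L[ℝ] E n, 2 ≤ d →
      IsMulOf (μ x) D ∧ HasFDerivAt (fun y => bchTerm μ d x y) D 0 := by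
    intro d
    by_cases h : 2 ≤ d
    · obtain ⟨D, hD⟩ := hasFDerivAt_bchTerm μ hs x d h
      exact ⟨D, fun _ => hD⟩
    · exact ⟨0, fun h' => absurd h' h⟩
  choose D hD using h2
  have hder : HasFDerivAt (fun y => bchMul μ x y)
      (1 + ∑ d ∈ Finset.Icc 2 n, D d : E n →L[ℝ] E n) 0 := by
    simp only [hsplit]
    exact ((hasFDerivAt_id _).const_add x).add
      (HasFDerivAt.fun_sum fun d hd => (hD d (Finset.mem_Icc.mp hd).1).2)
  obtain ⟨q, hq, hsum⟩ : IsMulOf (μ x) (∑ d ∈ Finset.Icc 2 n, D d) :=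
    IsMulOf.sum _ _ fun d hd => (hD d (Finset.mem_Icc.mp hd).1).1
  rw [dL, hder.fderiv, hsum]
  exact (hq.isNilpotent_mul_right (hN x)).isUnit_one_add

theorem exists_equiv_dL {n : ℕ} (μ : nilVariety n) (x : E n) :
    ∃ e : E n ≃L[ℝ] E n, (e : E n →L[ℝ] E n) = dL μ.1.1 x := by
  obtain ⟨u, hu⟩ := isUnit_dL μ x
  exact ⟨ContinuousLinearEquiv.ofUnit u, hu⟩

/-! ### Riemannian metrics on `ℝⁿ` -/

/-- The space of (smooth) Riemannian metrics on the manifold `ℝⁿ`; all tangent spaces are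
identified with `ℝⁿ` by translations. -/
structure Metric (n : ℕ) where
  /-- the inner product at a point -/
  inner : E n → E n →L[ℝ] E n →L[ℝ] ℝ
  symm : ∀ x v w, inner x v w = inner x w v
  pos : ∀ x v, v ≠ 0 → 0 < inner x v v
  smooth : ContDiff ℝ ∞ inner

/-- The compact-open `C^∞` topology: uniform convergence on compact sets of the derivatives
of all orders (the order zero included). -/
instance (n : ℕ) : TopologicalSpace (Metric n) :=
  TopologicalSpace.induced
    (fun (g : Metric n) (q : ℕ) =>
      UniformOnFun.ofFun {K : Set (E n) | IsCompact K} (iteratedFDeriv ℝ q g.inner))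
    inferInstance

theorem contDiff_inverse_dL {n : ℕ} (μ : nilVariety n) :
    ContDiff ℝ ∞ fun x => (dL μ.1.1 x).inverse := by
  rw [contDiff_iff_contDiffAt]
  intro x
  obtain ⟨e, he⟩ := exists_equiv_dL μ x
  have h1 : ContDiffAt ℝ ∞ ContinuousLinearMap.inverse (dL μ.1.1 x) := by
    rw [← he]
    exact contDiffAt_map_inverse e
  exact h1.comp x (contDiff_dL μ.1.1).contDiffAt

/-- The metric `g_μ`, for which `dL_μ(x)|₀ : T₀ℝⁿ → T_xℝⁿ` is an isometry for all `x`
(see `nilMetric_dL`). -/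
def nilMetric {n : ℕ} (μ : nilVariety n) : Metric n where
  inner x := ((innerSL ℝ).comp (dL μ.1.1 x).inverse).flip.comp (dL μ.1.1 x).inverse
  symm x v w := by
    simp [real_inner_comm]
  pos x v hv := by
    have h0 : (dL μ.1.1 x).inverse v ≠ 0 := by
      obtain ⟨e, he⟩ := exists_equiv_dL μ x
      rw [← he, ContinuousLinearMap.inverse_equiv]
      simpa using hv
    have h1 : 0 < ⟪(dL μ.1.1 x).inverse v, (dL μ.1.1 x).inverse v⟫_ℝ := real_inner_self_pos.mpr h0
    simpa using h1
  smooth := by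
    have h := contDiff_inverse_dL μ
    have h1 : ContDiff ℝ ∞ fun x => (innerSL ℝ).comp (dL μ.1.1 x).inverse :=
      contDiff_const.clm_comp h
    exact ((ContinuousLinearMap.flipₗᵢ ℝ (E n) (E n) ℝ).contDiff.comp h1).clm_comp h

theorem nilMetric_dL {n : ℕ} (μ : nilVariety n) (x v w : E n) :
    (nilMetric μ).inner x (dL μ.1.1 x v) (dL μ.1.1 x w) = ⟪v, w⟫_ℝ := by
  obtain ⟨e, he⟩ := exists_equiv_dL μ x
  simp [nilMetric, ← he, real_inner_comm]

/-! ### Covariant derivatives, in the global coordinates of `ℝⁿ` -/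

/-- The canonical basis vector `e_i`. -/
def basisVec {n : ℕ} (i : Fin n) : E n := EuclideanSpace.single i 1

/-- The partial derivative `∂f/∂x_i`. -/
def pderiv {n : ℕ} (i : Fin n) (f : E n → ℝ) (x : E n) : ℝ := fderiv ℝ f x (basisVec i)

/-- The matrix `(g_{ij}(x))`. -/
def Metric.mat {n : ℕ} (g : Metric n) (x : E n) : Matrix (Fin n) (Fin n) ℝ :=
  Matrix.of fun i j => g.inner x (basisVec i) (basisVec j)

/-- Christoffel symbols `Γ_{ij}^k` of the Levi-Civita connection of `g`. -/
def Metric.christoffel {n : ℕ} (g : Metric n) (i j k : Fin n) (x : E n) : ℝ :=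
  (1 / 2) * ∑ l, (g.mat x)⁻¹ k l *
    (pderiv i (fun z => g.mat z j l) x + pderiv j (fun z => g.mat z i l) x
      - pderiv l (fun z => g.mat z i j) x)

/-- Components of a covariant tensor field of rank `m`. -/
abbrev Tensor (n m : ℕ) : Type := (Fin m → Fin n) → E n → ℝ

/-- Covariant derivative `∇T`; the first index is the direction of differentiation. -/
def Metric.covDeriv {n : ℕ} (g : Metric n) {m : ℕ} (T : Tensor n m) : Tensor n (m + 1) :=
  fun I x => pderiv (I 0) (T (Fin.tail I)) x -
    ∑ s : Fin m, ∑ k : Fin n,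
      g.christoffel (I 0) (Fin.tail I s) k x * T (Function.update (Fin.tail I) s k) x

/-- The iterated covariant derivative `∇^q T`. -/
def Metric.iterCovDeriv {n : ℕ} (g : Metric n) {m : ℕ} (T : Tensor n m) :
    (q : ℕ) → Tensor n (m + q)
  | 0 => T
  | q + 1 => g.covDeriv (g.iterCovDeriv T q)

/-- The pointwise norm `‖T‖_g` of a covariant tensor field. -/
def Metric.tensorNorm {n : ℕ} (g : Metric n) {m : ℕ} (T : Tensor n m) (x : E n) : ℝ :=
  Real.sqrt (∑ I : Fin m → Fin n, ∑ J : Fin m → Fin n,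
    (∏ s, (g.mat x)⁻¹ (I s) (J s)) * T I x * T J x)

/-- The tensor field `h - g` of rank two. -/
def Metric.diff {n : ℕ} (h g : Metric n) : Tensor n 2 :=
  fun I x => h.mat x (I 0) (I 1) - g.mat x (I 0) (I 1)

/-- For every compact `K`, every `p` and every `ε > 0`, eventually
`‖∇^q (g_k - g)‖_g < ε` on `K` for all orders `q₀ ≤ q ≤ p`, where `∇` is the Levi-Civita
connection of `g`. For `q₀ = 0` this is convergence of `g_k` to `g` in `C^∞`, uniformly on
compact sets; for `q₀ = 1` the differences themselves are not controlled. -/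
def ConvSmooth {n : ℕ} (q₀ : ℕ) (gs : ℕ → Metric n) (g : Metric n) : Prop :=
  ∀ K : Set (E n), IsCompact K → ∀ p : ℕ, 0 < p → ∀ ε : ℝ, 0 < ε → ∃ k₀ : ℕ, ∀ k ≥ k₀,
    ∀ q : ℕ, q₀ ≤ q → q ≤ p → ∀ x ∈ K,
      g.tensorNorm (g.iterCovDeriv ((gs k).diff g) q) x < ε

end Nilmanifold

end

noncomputable section

namespace Nilmanifold

/-! The BCH product is polynomial in the bracket and in both points, and `dL` is invertible when the
bracket is nilpotent. Hence `g_μ(x)` depends smoothly on `(μ, x)` near `N_n × ℝⁿ`. Joint continuity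
of all derivatives in `(μ, x)` gives uniform convergence on compact sets, both for coordinate
derivatives and for covariant derivatives with respect to a fixed limit metric.

Conversely, the bracket is recovered from the first derivatives of the metric at the origin. Since
`dL_μ(tu) v = v + (t/2) μ(u, v) + O(t²)`, differentiating the isometry condition shows that `∂_u
g_μ(v, w)` at `0` is `-1/2` times `⟪μ(u, v), w⟫ + ⟪μ(u, w), v⟫`, which is the symmetric part of `ad
u` up to a constant factor. So it suffices that passing to symmetric parts is a closed embedding on
`N_n`.

It is injective by `eq_of_symmetricPart_eq`, an induction along the ascending central series which
ends with the fact that a skew nilpotent operator is zero. It is proper because `(ad u)²` has trace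
zero, so the symmetric part bounds `ad u` (`two_mul_sum_structureConst_sq`). Thus `μ ↦ g_μ ↦` first
jet is an embedding with both factors continuous, and `μ ↦ g_μ` is an embedding.

For the condition with orders `q ≥ 1` only: every `g_μ` is the canonical inner product at `0`, so
the first covariant derivative of `g_μ - g_λ` at `0` is exactly the difference of the first jets. -/

/-! ### Ascending central series of a nilpotent bracket -/

/-- A finite-dimensional Lie algebra with nilpotent adjoint operators has an exhausting ascending
central series (a form of Engel's theorem). -/
theorem LieAlgebra.exists_centralSeries {L : Type*} [LieRing L] [LieAlgebra ℝ L]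
    [FiniteDimensional ℝ L] (hN : ∀ x, IsNilpotent (LieAlgebra.ad ℝ L x)) :
    ∃ (Z : ℕ → Submodule ℝ L) (m : ℕ), Z 0 = ⊥ ∧ Z m = ⊤ ∧
      ∀ i, ∀ z ∈ Z (i + 1), ∀ x : L, ⁅x, z⁆ ∈ Z i := by
  have hnil : LieRing.IsNilpotent L := (LieAlgebra.isNilpotent_iff_forall (R := ℝ)).mpr hN
  obtain ⟨m, hm⟩ := (LieModule.isNilpotent_iff_exists_ucs_eq_top (R := ℝ)).mp hnil
  refine ⟨fun i => (LieSubmodule.ucs i (⊥ : LieSubmodule ℝ L L)).toSubmodule, m,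
    by simp, by simp [hm], fun i z hz x => ?_⟩
  simp only [LieSubmodule.ucs_succ] at hz
  exact (LieSubmodule.mem_normalizer _ _).mp hz x

/-- `ℝⁿ` as the underlying space of the Lie algebra with bracket `μ`. -/
def BracketAlgebra {n : ℕ} (_ : nilVariety n) : Type := E n

instance {n : ℕ} (μ : nilVariety n) : AddCommGroup (BracketAlgebra μ) :=
  inferInstanceAs (AddCommGroup (E n))

instance {n : ℕ} (μ : nilVariety n) : Module ℝ (BracketAlgebra μ) :=
  inferInstanceAs (Module ℝ (E n))

instance {n : ℕ} (μ : nilVariety n) : FiniteDimensional ℝ (BracketAlgebra μ) :=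
  inferInstanceAs (FiniteDimensional ℝ (E n))

theorem apply_self_eq_zero {n : ℕ} {μ : Bilin n} (hs : ∀ x y, μ x y = -μ y x) (x : E n) :
    μ x x = 0 := by
  have h : (2 : ℝ) • μ x x = 0 := by
    rw [two_smul]
    nth_rewrite 1 [hs x x]
    exact neg_add_cancel _
  exact (smul_eq_zero.mp h).resolve_left two_ne_zero

instance {n : ℕ} (μ : nilVariety n) : LieRing (BracketAlgebra μ) where
  bracket x y := μ.1.1 x y
  add_lie x y z := μ.1.1.map_add₂ x y z
  lie_add x y z := (μ.1.1 x).map_add y z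
  lie_self x := apply_self_eq_zero μ.1.2 x
  leibniz_lie x y z := μ.2.1 x y z

instance {n : ℕ} (μ : nilVariety n) : LieAlgebra ℝ (BracketAlgebra μ) where
  lie_smul t x y := (μ.1.1 x).map_smul t y

/-- A nilpotent Lie bracket has an exhausting ascending central series. -/
theorem exists_centralSeries {n : ℕ} (μ : nilVariety n) :
    ∃ (Z : ℕ → Submodule ℝ (E n)) (m : ℕ), Z 0 = ⊥ ∧ Z m = ⊤ ∧
      ∀ i, ∀ z ∈ Z (i + 1), ∀ x, μ.1.1 x z ∈ Z i := by
  refine LieAlgebra.exists_centralSeries (L := BracketAlgebra μ) fun x => ?_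
  obtain ⟨k, hk⟩ := μ.2.2 x
  refine ⟨k, ?_⟩
  have hpow : ∀ (j : ℕ) (y : BracketAlgebra μ),
      (LieAlgebra.ad ℝ (BracketAlgebra μ) x ^ j) y = (μ.1.1 x ^ j) y := by
    intro j
    induction j with
    | zero => intro y; rfl
    | succ j ih =>
      intro y
      rw [pow_succ, Module.End.mul_apply, ih]
      rw [pow_succ]
      rfl
  apply LinearMap.ext
  intro y
  rw [hpow, hk]
  rfl

/-! ### Injectivity of the symmetric part of `ad` -/

/-- Skewness gives `⟪A (A x), x⟫ = -‖A x‖²`, so `A²` and `A` have the same kernel, and powers can be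
lowered one at a time. -/
theorem eq_zero_of_skew_of_isNilpotent {V : Type*} [NormedAddCommGroup V] [InnerProductSpace ℝ V]
    {A : V →L[ℝ] V} (hA : ∀ x y, ⟪A x, y⟫_ℝ = -⟪A y, x⟫_ℝ) (hN : IsNilpotent A) : A = 0 := by
  have h2 : ∀ x, A (A x) = 0 → A x = 0 := by
    intro x hx
    have h := hA (A x) x
    rw [hx, inner_zero_left] at h
    exact inner_self_eq_zero.mp (neg_eq_zero.mp h.symm)
  obtain ⟨k, hk⟩ := hN
  have key : ∀ (j : ℕ) (x : V), (A ^ (j + 1)) x = 0 → A x = 0 := by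
    intro j
    induction j with
    | zero => intro x hx; simpa using hx
    | succ j ih =>
      intro x hx
      refine ih x ?_
      rw [pow_succ', mul_apply_eq_comp]
      apply h2
      rw [← hx, pow_succ', pow_succ']
      rfl
  ext1 x
  exact key k x (by rw [pow_succ', hk, mul_zero]; rfl)

/-- A nilpotent bracket is determined by the symmetric parts of its adjoint operators. -/
theorem eq_of_symmetricPart_eq {n : ℕ} (a b : nilVariety n)
    (h : ∀ x y w : E n, ⟪a.1.1 x y, w⟫_ℝ + ⟪a.1.1 x w, y⟫_ℝ
      = ⟪b.1.1 x y, w⟫_ℝ + ⟪b.1.1 x w, y⟫_ℝ) : a = b := by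
  obtain ⟨Z, m, hZ0, hZm, hcentral⟩ := exists_centralSeries a
  obtain ⟨⟨a, hsa⟩, hJa, hNa⟩ := a
  obtain ⟨⟨b, hsb⟩, hJb, hNb⟩ := b
  change ∀ x y, a x y = -a y x at hsa
  change ∀ x y, b x y = -b y x at hsb
  change ∀ x, IsNilpotent (b x) at hNb
  simp only at h hcentral
  have hskew : ∀ x y, (b - a) x y = -(b - a) y x := by
    intro x y
    simp only [sub_apply, hsa x y, hsb x y]
    abel
  have hinner : ∀ x y w, ⟪(b - a) x y, w⟫_ℝ = -⟪(b - a) x w, y⟫_ℝ := by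
    intro x y w
    simp only [sub_apply, inner_sub_left]
    linarith [h x y w]
  -- The difference `D = b - a` is now alternating in all three of its arguments; it is shown to
  -- vanish along the central series of `a`.
  have key : ∀ i, ∀ z ∈ Z i, (b - a) z = 0 := by
    intro i
    induction i with
    | zero =>
      intro z hz
      rw [hZ0, Submodule.mem_bot] at hz
      rw [hz, map_zero]
    | succ i ih =>
      intro z hz
      have hkill : ∀ u ∈ Z i, (b - a) z u = 0 := by
        intro u hu
        rw [hskew, ih u hu]
        simp
      have horth : ∀ x, (b - a) z x ∈ (Z i)ᗮ := by
        intro x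
        rw [Submodule.mem_orthogonal']
        intro u hu
        rw [hinner, hkill u hu, inner_zero_left, neg_zero]
      set P := (Z i)ᗮ.starProjection with hP
      have hPker : ∀ u ∈ Z i, P u = 0 := by
        intro u hu
        rw [hP, Submodule.starProjection_apply_eq_zero_iff, Submodule.orthogonal_orthogonal]
        exact hu
      have hPid : ∀ u ∈ (Z i)ᗮ, P u = u := fun u hu =>
        Submodule.starProjection_eq_self_iff.mpr hu
      -- With `P` the projection onto the complement of `Z i`, the part of `b z` coming from `a z`
      -- lies in `Z i` and is killed, while `D z` both kills `Z i` and maps into its complement. So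
      -- `P` intertwines `b z` with `D z`, and the nilpotency of `b z` passes to `D z`.
      have hcomm : ∀ y, P (b z y) = (b - a) z (P y) := by
        intro y
        have h1 : b z y = a z y + (b - a) z y := by simp
        have h2 : P (a z y) = 0 := by
          apply hPker
          rw [hsa]
          exact neg_mem (hcentral i z hz y)
        have h3 : (b - a) z (y - P y) = 0 := by
          apply hkill
          rw [← Submodule.orthogonal_orthogonal (Z i)]
          exact Submodule.sub_starProjection_mem_orthogonal y
        rw [map_sub, sub_eq_zero] at h3
        rw [h1, map_add, h2, zero_add, hPid _ (horth y), h3]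
      have hpow : ∀ (k : ℕ) (y : E n), P ((b z ^ k) y) = ((b - a) z ^ k) (P y) := by
        intro k
        induction k with
        | zero => intro y; simp
        | succ k ihk =>
          intro y
          rw [pow_succ, pow_succ, mul_apply_eq_comp, mul_apply_eq_comp,
            ihk, hcomm]
      refine eq_zero_of_skew_of_isNilpotent (hinner z) ?_
      obtain ⟨k, hk⟩ := hNb z
      -- The extra factor moves the argument into the complement of `Z i`, where `P` is the
      -- identity.
      refine ⟨k + 1, ?_⟩
      ext1 y
      rw [pow_succ, mul_apply_eq_comp, ← hPid _ (horth y), ← hpow, hk]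
      simp
  have hab : a = b := by
    ext1 z
    have := key m z (by rw [hZm]; trivial)
    exact (sub_eq_zero.mp this).symm
  subst hab
  rfl

/-! ### Structure constants and properness -/

/-- The structure constants of a bilinear map. -/
def structureConst {n : ℕ} (μ : Bilin n) (i j l : Fin n) : ℝ :=
  ⟪μ (basisVec i) (basisVec j), basisVec l⟫_ℝ

theorem inner_basisVec {n : ℕ} (v : E n) (l : Fin n) : ⟪v, basisVec l⟫_ℝ = v l := by
  simp [basisVec, EuclideanSpace.inner_single_right]

theorem sum_smul_basisVec {n : ℕ} (v : E n) : ∑ i, v i • basisVec i = v := by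
  ext j
  simp [basisVec, Finset.sum_apply, Pi.single_apply]

theorem ext_structureConst {n : ℕ} {μ ν : Bilin n}
    (h : ∀ i j l, structureConst μ i j l = structureConst ν i j l) : μ = ν := by
  have hb : ∀ i j, μ (basisVec i) (basisVec j) = ν (basisVec i) (basisVec j) := by
    intro i j
    ext l
    simpa only [structureConst, inner_basisVec] using h i j l
  ext1 x
  ext1 y
  rw [← sum_smul_basisVec x, ← sum_smul_basisVec y]
  simp only [map_sum, map_smul, sum_apply, smul_apply, hb]

/-- The symmetric part of the structure constants. -/
def symStructureConst {n : ℕ} (μ : Bilin n) (i j l : Fin n) : ℝ :=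
  structureConst μ i j l + structureConst μ i l j

theorem eq_of_symStructureConst_eq {n : ℕ} (a b : nilVariety n)
    (h : ∀ i j l, symStructureConst a.1.1 i j l = symStructureConst b.1.1 i j l) : a = b := by
  apply eq_of_symmetricPart_eq
  intro x y w
  simp only [symStructureConst, structureConst] at h
  have h1 : ∀ i j, ⟪a.1.1 (basisVec i) (basisVec j), w⟫_ℝ + ⟪a.1.1 (basisVec i) w, basisVec j⟫_ℝ
      = ⟪b.1.1 (basisVec i) (basisVec j), w⟫_ℝ + ⟪b.1.1 (basisVec i) w, basisVec j⟫_ℝ := by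
    intro i j
    rw [← sum_smul_basisVec w]
    simp only [map_sum, map_smul, inner_sum, sum_inner, inner_smul_left, inner_smul_right,
      ← Finset.sum_add_distrib, RCLike.conj_to_real, ← mul_add, h]
  have h2 : ∀ i, ⟪a.1.1 (basisVec i) y, w⟫_ℝ + ⟪a.1.1 (basisVec i) w, y⟫_ℝ
      = ⟪b.1.1 (basisVec i) y, w⟫_ℝ + ⟪b.1.1 (basisVec i) w, y⟫_ℝ := by
    intro i
    rw [← sum_smul_basisVec y]
    simp only [map_sum, map_smul, inner_sum, sum_inner, inner_smul_left, inner_smul_right,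
      ← Finset.sum_add_distrib, RCLike.conj_to_real, ← mul_add, h1]
  rw [← sum_smul_basisVec x]
  simp only [map_sum, map_smul, sum_apply, smul_apply, sum_inner, inner_smul_left,
    ← Finset.sum_add_distrib, RCLike.conj_to_real, ← mul_add, h2]

/-- The square of a nilpotent operator has trace zero. -/
theorem sum_structureConst_mul {n : ℕ} (μ : nilVariety n) (i : Fin n) :
    ∑ j, ∑ l, structureConst μ.1.1 i j l * structureConst μ.1.1 i l j = 0 := by
  have hN : IsNilpotent (((μ.1.1 (basisVec i) : E n →L[ℝ] E n) : E n →ₗ[ℝ] E n) ^ 2) := by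
    obtain ⟨k, hk⟩ := μ.2.2 (basisVec i)
    refine IsNilpotent.pow_of_pos ⟨k, ?_⟩ two_ne_zero
    have h := congrArg (fun A : E n →L[ℝ] E n => (A : E n →ₗ[ℝ] E n)) hk
    simpa using h
  have h := (LinearMap.isNilpotent_trace_of_isNilpotent hN).eq_zero
  rw [LinearMap.trace_eq_sum_inner _ (EuclideanSpace.basisFun (Fin n) ℝ)] at h
  rw [← h]
  refine Finset.sum_congr rfl fun j _ => ?_
  have hb : ∀ l, EuclideanSpace.basisFun (Fin n) ℝ l = basisVec l := fun l => by
    simp [basisVec]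
  rw [hb, pow_two, Module.End.mul_apply]
  simp only [ContinuousLinearMap.coe_coe]
  conv_rhs => rw [← sum_smul_basisVec (μ.1.1 (basisVec i) (basisVec j))]
  simp only [map_sum, map_smul, inner_sum, inner_smul_right, structureConst, inner_basisVec]
  refine Finset.sum_congr rfl fun l _ => ?_
  rw [real_inner_comm, inner_basisVec]

/-- In the expansion of the squares on the right, the cross terms sum to twice the trace of `(ad
e_i)²`, which is zero. This is the a priori bound behind properness. -/
theorem two_mul_sum_structureConst_sq {n : ℕ} (μ : nilVariety n) (i : Fin n) :
    2 * ∑ j, ∑ l, structureConst μ.1.1 i j l ^ 2 = ∑ j, ∑ l, symStructureConst μ.1.1 i j l ^ 2 := by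
  have h1 := sum_structureConst_mul μ i
  have h2 : ∑ j, ∑ l, structureConst μ.1.1 i l j ^ 2 = ∑ j, ∑ l, structureConst μ.1.1 i j l ^ 2 :=
    Finset.sum_comm
  have h3 : ∀ j l, symStructureConst μ.1.1 i j l ^ 2 = structureConst μ.1.1 i j l ^ 2
      + 2 * (structureConst μ.1.1 i j l * structureConst μ.1.1 i l j)
      + structureConst μ.1.1 i l j ^ 2 := fun j l => by
    rw [symStructureConst]
    ring
  simp only [h3, Finset.sum_add_distrib, ← Finset.mul_sum, h1, h2]
  ring

/-- Nilpotency becomes a closed condition once the exponent is uniform: in dimension `n` the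
exponent `n` always suffices. -/
theorem isClosed_nilVariety {n : ℕ} : IsClosed (nilVariety n) := by
  have hcoe : Continuous fun μ : skewBilin n => (μ : Bilin n) := continuous_subtype_val
  have h : nilVariety n = {μ | ∀ x y z, μ.1 x (μ.1 y z) = μ.1 (μ.1 x y) z + μ.1 y (μ.1 x z)} ∩
      {μ | ∀ x, μ.1 x ^ n = 0} := by
    ext μ
    refine and_congr Iff.rfl (forall_congr' fun x => ⟨fun hx => ?_, fun hx => ⟨n, hx⟩⟩)
    have hx' : IsNilpotent ((μ.1 x : E n →L[ℝ] E n) : E n →ₗ[ℝ] E n) := by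
      obtain ⟨k, hk⟩ := hx
      refine ⟨k, ?_⟩
      have h := congrArg (fun A : E n →L[ℝ] E n => (A : E n →ₗ[ℝ] E n)) hk
      simpa using h
    obtain ⟨k, hk⟩ := hx'
    have h1 := Module.End.ker_pow_le_ker_pow_finrank ((μ.1 x : E n →L[ℝ] E n) : E n →ₗ[ℝ] E n) k
    rw [hk, LinearMap.ker_zero, finrank_euclideanSpace_fin] at h1
    ext1 y
    have h2 := h1 (Submodule.mem_top (x := y))
    simpa [Module.End.pow_apply] using h2
  rw [h]
  refine IsClosed.inter ?_ ?_
  · simp only [Set.ofPred_forall]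
    refine isClosed_iInter fun x => isClosed_iInter fun y => isClosed_iInter fun z =>
      isClosed_eq ?_ ?_ <;> fun_prop
  · simp only [Set.ofPred_forall]
    exact isClosed_iInter fun x => isClosed_eq (by fun_prop) continuous_const

theorem IsLinearMap.isClosedEmbedding_of_injective {V W : Type*} [NormedAddCommGroup V]
    [NormedSpace ℝ V] [FiniteDimensional ℝ V] [NormedAddCommGroup W] [NormedSpace ℝ W] {f : V → W}
    (hf : IsLinearMap ℝ f) (hinj : Function.Injective f) : IsClosedEmbedding f :=
  LinearMap.isClosedEmbedding_of_injective (f := hf.mk' f) (LinearMap.ker_eq_bot.mpr hinj)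

theorem isClosedEmbedding_structureConst {n : ℕ} :
    IsClosedEmbedding fun μ : nilVariety n => structureConst μ.1.1 := by
  have hc : IsClosedEmbedding (structureConst : Bilin n → Fin n → Fin n → Fin n → ℝ) := by
    refine IsLinearMap.isClosedEmbedding_of_injective ⟨fun a b => ?_, fun t a => ?_⟩ fun a b hab =>
      ext_structureConst fun i j l => congrFun (congrFun (congrFun hab i) j) l
    · ext i j l
      simp [structureConst, inner_add_left]
    · ext i j l
      simp [structureConst, inner_smul_left]
  have hclosed : IsClosed (skewBilin n : Set (Bilin n)) := by
    have h : (skewBilin n : Set (Bilin n)) = {μ | ∀ x y, μ x y = -μ y x} := rfl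
    rw [h]
    simp only [Set.ofPred_forall]
    exact isClosed_iInter fun x => isClosed_iInter fun y =>
      isClosed_eq (by fun_prop) (by fun_prop)
  have hs : IsClosedEmbedding fun μ : skewBilin n => (μ : Bilin n) :=
    hclosed.isClosedEmbedding_subtypeVal
  exact hc.comp (hs.comp isClosed_nilVariety.isClosedEmbedding_subtypeVal)

/-- A bound on the symmetric parts bounds all structure constants, so preimages of compact sets are
compact; a proper continuous injection is a closed embedding. -/
theorem isClosedEmbedding_symStructureConst {n : ℕ} :
    IsClosedEmbedding fun μ : nilVariety n => symStructureConst μ.1.1 := by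
  have hcont : Continuous fun μ : nilVariety n => symStructureConst μ.1.1 := by
    have h := (isClosedEmbedding_structureConst (n := n)).continuous
    refine continuous_pi fun i => continuous_pi fun j => continuous_pi fun l => ?_
    have h' : ∀ i j l, Continuous fun μ : nilVariety n => structureConst μ.1.1 i j l :=
      fun i j l =>
        (continuous_apply l).comp ((continuous_apply j).comp ((continuous_apply i).comp h))
    exact (h' i j l).add (h' i l j)
  have hproper : IsProperMap fun μ : nilVariety n => symStructureConst μ.1.1 := by
    rw [isProperMap_iff_isCompact_preimage]
    refine ⟨hcont, fun K hK => ?_⟩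
    obtain ⟨R, hR⟩ := hK.isBounded.exists_norm_le
    have hR' : ∀ μ : nilVariety n, symStructureConst μ.1.1 ∈ K →
        ∀ i j l, |symStructureConst μ.1.1 i j l| ≤ R := fun μ hμ i j l =>
      (((norm_le_pi_norm (symStructureConst μ.1.1 i j) l).trans (norm_le_pi_norm _ j)).trans
        (norm_le_pi_norm (symStructureConst μ.1.1) i)).trans (hR _ hμ)
    refine (isClosedEmbedding_structureConst.isCompact_preimage
      (isCompact_closedBall (0 : Fin n → Fin n → Fin n → ℝ) (n * |R|))).of_isClosed_subset
      (hK.isClosed.preimage hcont) fun μ hμ => ?_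
    -- The trace identity gives `2 c² ≤ n² R²` for each structure constant `c`; the radius `n |R|`
    -- is not sharp. The absolute value is needed because `R` carries no sign.
    have hn : 0 ≤ n * |R| := by positivity
    rw [Set.mem_preimage, mem_closedBall_zero_iff]
    refine (pi_norm_le_iff_of_nonneg hn).mpr fun i => (pi_norm_le_iff_of_nonneg hn).mpr fun j =>
      (pi_norm_le_iff_of_nonneg hn).mpr fun l => ?_
    rw [Real.norm_eq_abs]
    refine abs_le_of_sq_le_sq ?_ hn
    have h1 : structureConst μ.1.1 i j l ^ 2 ≤ ∑ j, ∑ l, structureConst μ.1.1 i j l ^ 2 :=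
      (Finset.single_le_sum (f := fun l => structureConst μ.1.1 i j l ^ 2)
        (fun _ _ => sq_nonneg _) (Finset.mem_univ l)).trans
      (Finset.single_le_sum (f := fun j => ∑ l, structureConst μ.1.1 i j l ^ 2)
        (fun _ _ => Finset.sum_nonneg fun _ _ => sq_nonneg _) (Finset.mem_univ j))
    have h2 : ∑ j, ∑ l, symStructureConst μ.1.1 i j l ^ 2 ≤ ∑ _j : Fin n, ∑ _l : Fin n, |R| ^ 2 :=
      Finset.sum_le_sum fun j _ => Finset.sum_le_sum fun l _ =>
        sq_le_sq' (neg_le_of_abs_le ((hR' μ hμ i j l).trans (le_abs_self R)))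
          ((le_abs_self _).trans ((hR' μ hμ i j l).trans (le_abs_self R)))
    have h3 := two_mul_sum_structureConst_sq μ i
    have h4 := sq_nonneg (structureConst μ.1.1 i j l)
    simp only [Finset.sum_const, Finset.card_univ, Fintype.card_fin, nsmul_eq_mul] at h2
    nlinarith
  exact (IsClosedEmbedding.of_continuous_injective_isClosedMap hcont (fun a b hab =>
      eq_of_symStructureConst_eq a b fun i j l => congrFun (congrFun (congrFun hab i) j) l)
      hproper.isClosedMap)

/-! ### Low-degree terms of the Baker-Campbell-Hausdorff product -/

theorem nested_map_smul {n : ℕ} (μ : Bilin n) (t : ℝ) :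
    ∀ l : List (E n), nested μ (l.map (t • ·)) = t ^ l.length • nested μ l
  | [] => by simp [nested]
  | [a] => by simp [nested]
  | a :: b :: l => by
    have h := nested_map_smul μ t (b :: l)
    have h1 : nested μ ((a :: b :: l).map (t • ·)) = μ (t • a) (nested μ ((b :: l).map (t • ·))) :=
      rfl
    rw [h1, h, map_smul, map_smul, smul_apply, smul_smul]
    rw [List.length_cons (as := b :: l), pow_succ]
    rfl

/-- The degree `d` component of the Baker-Campbell-Hausdorff series is homogeneous. -/
theorem bchTerm_smul {n : ℕ} (μ : Bilin n) (d : ℕ) (t : ℝ) (x y : E n) :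
    bchTerm μ d (t • x) (t • y) = t ^ d • bchTerm μ d x y := by
  unfold bchTerm
  simp only [Finset.smul_sum]
  refine Finset.sum_congr rfl fun m _ => Finset.sum_congr rfl fun ρ hρ => ?_
  rw [smul_comm]
  congr 1
  obtain ⟨w, hl, hw⟩ := dynkinWord_eq (n := n) ρ
  rw [(Finset.mem_filter.mp hρ).2.2] at hl
  have h : (w.map fun b => cond b (t • x) (t • y)) = (w.map fun b => cond b x y).map (t • ·) := by
    rw [List.map_map]
    refine List.map_congr_left fun b _ => ?_
    cases b <;> rfl
  rw [hw, hw, h, nested_map_smul, List.length_map, hl]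

/-- The degree two component of the Baker-Campbell-Hausdorff series is half the bracket. -/
theorem bchTerm_two {n : ℕ} (μ : Bilin n) (hs : ∀ x y, μ x y = -μ y x) (x y : E n) :
    bchTerm μ 2 x y = (1 / 2 : ℝ) • μ x y := by
  have hxx : ∀ x, μ x x = 0 := apply_self_eq_zero hs
  have h1 : (Finset.univ.filter fun ρ : Fin 1 → Fin (2 + 1) × Fin (2 + 1) =>
      (∀ i, 0 < ((ρ i).1 : ℕ) + ((ρ i).2 : ℕ)) ∧
        ∑ i, (((ρ i).1 : ℕ) + ((ρ i).2 : ℕ)) = 2) = {![(2, 0)], ![(1, 1)], ![(0, 2)]} := by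
    decide
  have h2 : (Finset.univ.filter fun ρ : Fin 2 → Fin (2 + 1) × Fin (2 + 1) =>
      (∀ i, 0 < ((ρ i).1 : ℕ) + ((ρ i).2 : ℕ)) ∧
        ∑ i, (((ρ i).1 : ℕ) + ((ρ i).2 : ℕ)) = 2) =
      {![(1, 0), (1, 0)], ![(1, 0), (0, 1)], ![(0, 1), (1, 0)], ![(0, 1), (0, 1)]} := by
    decide +kernel
  have h3 : Finset.Icc 1 2 = {1, 2} := rfl
  unfold bchTerm
  rw [h3, Finset.sum_pair (by decide), h1, h2]
  rw [Finset.sum_insert (by decide), Finset.sum_insert (by decide), Finset.sum_singleton,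
    Finset.sum_insert (by decide), Finset.sum_insert (by decide), Finset.sum_insert (by decide),
    Finset.sum_singleton]
  -- The word `xy` with `m = 1` contributes `1/2`; for `m = 2` the words `xy` and `yx` have equal
  -- coefficients and cancel by skewness.
  simp [dynkinWord, nested, hxx, List.replicate_succ, hs y x]

theorem contDiff_bchTerm {n : ℕ} (μ : Bilin n) (d : ℕ) :
    ContDiff ℝ ∞ fun p : E n × E n => bchTerm μ d p.1 p.2 := by
  unfold bchTerm
  refine ContDiff.sum fun m _ => ContDiff.sum fun ρ _ => ContDiff.const_smul _ ?_
  obtain ⟨w, -, hw⟩ := dynkinWord_eq (n := n) ρ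
  simp only [hw]
  exact contDiff_nestedW μ w

theorem differentiable_bchTerm {n : ℕ} (μ : Bilin n) (d : ℕ) (x : E n) :
    Differentiable ℝ fun y => bchTerm μ d x y :=
  ((contDiff_bchTerm μ d).comp (contDiff_prodMk_right x)).differentiable (by simp)

/-- The contribution to `dL` of the terms of degree `d + 1` is homogeneous of degree `d`. -/
theorem fderiv_bchTerm_smul {n : ℕ} (μ : Bilin n) (d : ℕ) (t : ℝ) (ht : t ≠ 0) (x v : E n) :
    fderiv ℝ (fun y => bchTerm μ (d + 1) (t • x) y) 0 v
      = t ^ d • fderiv ℝ (fun y => bchTerm μ (d + 1) x y) 0 v := by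
  have h : (fun y => bchTerm μ (d + 1) (t • x) y)
      = fun y => t ^ (d + 1) • bchTerm μ (d + 1) x (t⁻¹ • y) := by
    ext1 y
    rw [← bchTerm_smul, smul_inv_smul₀ ht]
  have h1 : HasFDerivAt (fun y => bchTerm μ (d + 1) x y)
      (fderiv ℝ (fun y => bchTerm μ (d + 1) x y) 0) (t⁻¹ • (0 : E n)) := by
    rw [smul_zero]
    exact (differentiable_bchTerm μ (d + 1) x 0).hasFDerivAt
  have h2 : HasFDerivAt (fun y : E n => t⁻¹ • y) (t⁻¹ • ContinuousLinearMap.id ℝ (E n)) 0 :=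
    (hasFDerivAt_id (0 : E n)).const_smul t⁻¹
  have h3 : HasFDerivAt (fun y => t ^ (d + 1) • bchTerm μ (d + 1) x (t⁻¹ • y))
      (t ^ (d + 1) • (fderiv ℝ (fun y => bchTerm μ (d + 1) x y) 0).comp
        (t⁻¹ • ContinuousLinearMap.id ℝ (E n))) 0 :=
    (h1.comp (0 : E n) h2).fun_const_smul (t ^ (d + 1))
  rw [h, h3.fderiv]
  simp only [smul_apply, ContinuousLinearMap.comp_apply, map_smul, smul_smul,
    ContinuousLinearMap.id_apply]
  congr 1
  field_simp
  ring

theorem dL_eq_sum {n : ℕ} (μ : Bilin n) (x : E n) :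
    dL μ x = ∑ d ∈ Finset.Icc 1 n, fderiv ℝ (fun y => bchTerm μ d x y) 0 := by
  unfold dL bchMul
  exact (HasFDerivAt.fun_sum fun d _ => (differentiable_bchTerm μ d x 0).hasFDerivAt).fderiv

theorem fderiv_bchTerm_one {n : ℕ} (μ : Bilin n) (x : E n) :
    fderiv ℝ (fun y => bchTerm μ 1 x y) 0 = 1 := by
  simp only [bchTerm_one]
  exact ((hasFDerivAt_id (𝕜 := ℝ) (0 : E n)).const_add x).fderiv

theorem fderiv_bchTerm_two {n : ℕ} (μ : Bilin n) (hs : ∀ x y, μ x y = -μ y x) (x : E n) :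
    fderiv ℝ (fun y => bchTerm μ 2 x y) 0 = (1 / 2 : ℝ) • μ x := by
  simp only [bchTerm_two μ hs]
  exact ((μ x).hasFDerivAt.const_smul (1 / 2 : ℝ)).fderiv

/-- For `n ≤ 1` the truncated series has no quadratic term, so the expansion of `dL` is only correct
because the bracket itself vanishes. -/
theorem bilin_eq_zero_of_le_one {n : ℕ} (hn : n ≤ 1) (μ : Bilin n)
    (hs : ∀ x y, μ x y = -μ y x) : μ = 0 := by
  refine ext_structureConst fun i j l => ?_
  have hij : i = j := Fin.ext (by omega)
  subst hij
  simp [structureConst, apply_self_eq_zero hs]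

/-- Homogeneity with `t = 2` at the fixed point `0` makes the value equal to `2 ^ d` times itself.
-/
theorem fderiv_bchTerm_zero {n : ℕ} (μ : Bilin n) (d : ℕ) (hd : d ≠ 0) (v : E n) :
    fderiv ℝ (fun y => bchTerm μ (d + 1) 0 y) 0 v = 0 := by
  have h := fderiv_bchTerm_smul μ d 2 two_ne_zero 0 v
  rw [smul_zero] at h
  have h1 : ((2 : ℝ) ^ d - 1) • fderiv ℝ (fun y => bchTerm μ (d + 1) 0 y) 0 v = 0 := by
    rw [sub_smul, one_smul, ← h, sub_self]
  exact (smul_eq_zero.mp h1).resolve_left (sub_ne_zero.mpr (one_lt_pow₀ one_lt_two hd).ne')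

/-- Along a ray `dL` is a polynomial in `t`. The value `t = 0` is treated separately, since the
homogeneity argument rescales by `t⁻¹`. -/
theorem dL_smul {n : ℕ} (μ : Bilin n) (t : ℝ) (x v : E n) :
    dL μ (t • x) v =
      ∑ d ∈ Finset.range n, t ^ d • fderiv ℝ (fun y => bchTerm μ (d + 1) x y) 0 v := by
  have hIcc : Finset.Icc 1 n = (Finset.range n).image (· + 1) := by
    ext d
    simp only [Finset.mem_Icc, Finset.mem_image, Finset.mem_range]
    exact ⟨fun h => ⟨d - 1, by omega, by omega⟩, by rintro ⟨a, h, rfl⟩; omega⟩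
  rw [dL_eq_sum, hIcc, Finset.sum_image fun _ _ _ _ h => Nat.succ_injective h, sum_apply]
  refine Finset.sum_congr rfl fun d _ => ?_
  rcases eq_or_ne t 0 with rfl | ht
  · rcases eq_or_ne d 0 with rfl | hd
    · simp only [zero_add, fderiv_bchTerm_one, pow_zero, one_smul]
    · rw [zero_smul, fderiv_bchTerm_zero μ d hd, zero_pow hd, zero_smul]
  · exact fderiv_bchTerm_smul μ d t ht x v

theorem dL_zero {n : ℕ} (μ : Bilin n) : dL μ 0 = 1 := by
  rcases Nat.eq_zero_or_pos n with rfl | hn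
  · exact Subsingleton.elim _ _
  · ext1 v
    have h := dL_smul μ 0 0 v
    rw [zero_smul, Finset.sum_eq_single_of_mem 0 (Finset.mem_range.mpr hn)
      fun d _ hd => by rw [zero_pow hd, zero_smul]] at h
    rw [h, pow_zero, one_smul, zero_add, fderiv_bchTerm_one]

/-- The first order expansion of `dL` at the origin. -/
theorem hasDerivAt_dL {n : ℕ} (μ : Bilin n) (hs : ∀ x y, μ x y = -μ y x) (x v : E n) :
    HasDerivAt (fun t : ℝ => dL μ (t • x) v) ((1 / 2 : ℝ) • μ x v) 0 := by
  simp only [dL_smul]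
  have h : HasDerivAt (fun t : ℝ =>
      ∑ d ∈ Finset.range n, t ^ d • fderiv ℝ (fun y => bchTerm μ (d + 1) x y) 0 v)
      (∑ d ∈ Finset.range n, ((d : ℝ) * 0 ^ (d - 1)) •
        fderiv ℝ (fun y => bchTerm μ (d + 1) x y) 0 v) 0 :=
    HasDerivAt.fun_sum fun d _ => (hasDerivAt_pow d (0 : ℝ)).smul_const _
  convert h using 1
  rcases Nat.lt_or_ge 1 n with hn | hn
  -- Only `d = 1` survives: the factor `d` kills `d = 0`, and `0 ^ (d - 1)` kills `d ≥ 2`.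
  · rw [Finset.sum_eq_single_of_mem 1 (Finset.mem_range.mpr hn)]
    · simp [fderiv_bchTerm_two μ hs]
    · intro d _ hd
      rcases Nat.eq_zero_or_pos d with rfl | hd0
      · simp
      · rw [zero_pow (by omega), mul_zero, zero_smul]
  · rw [bilin_eq_zero_of_le_one hn μ hs]
    symm
    rw [zero_apply, zero_apply, smul_zero]
    refine Finset.sum_eq_zero fun d hd => ?_
    have hd0 : d = 0 := by have := Finset.mem_range.mp hd; omega
    simp [hd0]

/-! ### First jet of `g_μ` at the origin -/

theorem _root_.HasFDerivAt.hasDerivAt_smul {V W : Type*} [NormedAddCommGroup V] [NormedSpace ℝ V]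
    [NormedAddCommGroup W] [NormedSpace ℝ W] {f : V → W} {f' : V →L[ℝ] W}
    (hf : HasFDerivAt f f' 0) (u : V) : HasDerivAt (fun t : ℝ => f (t • u)) (f' u) 0 := by
  have h : HasDerivAt (fun t : ℝ => f (0 + t • u)) (f' u) 0 := hf.hasLineDerivAt u
  simpa only [zero_add] using h

theorem nilMetric_zero {n : ℕ} (μ : nilVariety n) (v w : E n) :
    (nilMetric μ).inner 0 v w = ⟪v, w⟫_ℝ := by
  have h := nilMetric_dL μ 0 v w
  rwa [dL_zero] at h

/-- The partial derivatives of the coefficients of `g_μ` at the origin. -/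
theorem fderiv_nilMetric_zero {n : ℕ} (μ : nilVariety n) (u v w : E n) :
    fderiv ℝ (nilMetric μ).inner 0 u v w
      = -(1 / 2) * (⟪μ.1.1 u v, w⟫_ℝ + ⟪μ.1.1 u w, v⟫_ℝ) := by
  have hg : HasDerivAt (fun t : ℝ => (nilMetric μ).inner (t • u))
      (fderiv ℝ (nilMetric μ).inner 0 u) 0 :=
    ((nilMetric μ).smooth.differentiable (by simp) 0).hasFDerivAt.hasDerivAt_smul u
  have hd := hasDerivAt_dL μ.1.1 μ.1.2 u
  -- Product rule for `t ↦ g_μ(tu)(dL_μ(tu) v, dL_μ(tu) w)`, which is constant by the isometry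
  -- property.
  have h := (hg.clm_apply (hd v)).clm_apply (hd w)
  simp only [nilMetric_dL] at h
  have h0 := h.unique (hasDerivAt_const (0 : ℝ) ⟪v, w⟫_ℝ)
  simp only [zero_smul, dL_zero, add_apply, map_smul, smul_apply, nilMetric_zero,
    smul_eq_mul, one_apply_eq_self] at h0
  rw [real_inner_comm (μ.1.1 u w)] at h0
  linarith

/-! ### Smooth dependence on the bracket and continuity of `μ ↦ g_μ` -/

section ParametricDerivatives

variable {P V W : Type*} [NormedAddCommGroup P] [NormedSpace ℝ P] [NormedAddCommGroup V]
  [NormedSpace ℝ V] [NormedAddCommGroup W] [NormedSpace ℝ W]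

theorem _root_.ContDiffAt.fderiv_snd {F : P → V → W} {p : P × V}
    (hF : ContDiffAt ℝ ∞ (fun q : P × V => F q.1 q.2) p) :
    ContDiffAt ℝ ∞ (fun q : P × V => fderiv ℝ (F q.1) q.2) p := by
  refine ContDiffAt.fderiv (n := ∞) (f := fun (q : P × V) (y : V) => F q.1 y) (g := Prod.snd)
    ?_ contDiffAt_snd (by simp)
  have h : ContDiffAt ℝ ∞ (fun r : (P × V) × V => (r.1.1, r.2)) (p, p.2) := by fun_prop
  exact ContDiffAt.comp (p, p.2) (g := fun q : P × V => F q.1 q.2) hF h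

theorem _root_.ContDiffAt.iteratedFDeriv_snd {F : P → V → W} {p : P × V}
    (hF : ContDiffAt ℝ ∞ (fun q : P × V => F q.1 q.2) p) (k : ℕ) :
    ContDiffAt ℝ ∞ (fun q : P × V => iteratedFDeriv ℝ k (F q.1) q.2) p := by
  induction k with
  | zero =>
    simp only [iteratedFDeriv_zero_eq_comp]
    exact (LinearIsometryEquiv.contDiff _).contDiffAt.comp p hF
  | succ k ih =>
    simp only [iteratedFDeriv_succ_eq_comp_left]
    exact (LinearIsometryEquiv.contDiff _).contDiffAt.comp p
      (ih.fderiv_snd (F := fun a b => iteratedFDeriv ℝ k (F a) b))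

end ParametricDerivatives

/-- Currying a jointly continuous map gives a continuous map into `C(Y, Z)` with the compact-open
topology, where convergence is uniform on compact sets. -/
theorem tendstoUniformlyOn_of_continuous_uncurry {X Y Z ι : Type*} [TopologicalSpace X]
    [TopologicalSpace Y] [UniformSpace Z] {F : X → Y → Z}
    (h : Continuous fun p : X × Y => F p.1 p.2) {a : ι → X} {b : X} {l : Filter ι}
    (ha : Tendsto a l (𝓝 b)) {K : Set Y} (hK : IsCompact K) :
    TendstoUniformlyOn (fun i => F (a i)) (F b) l K := by
  let f : X → C(Y, Z) := fun x => ⟨F x, h.comp (Continuous.prodMk_right x)⟩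
  have hf : Continuous f := ContinuousMap.continuous_of_continuous_uncurry f h
  exact ContinuousMap.tendsto_iff_forall_isCompact_tendstoUniformlyOn.mp ((hf.tendsto b).comp ha)
    K hK

theorem continuous_ofFun_of_uncurry {X Y Z : Type*} [TopologicalSpace X]
    [TopologicalSpace Y] [UniformSpace Z] {F : X → Y → Z}
    (h : Continuous fun p : X × Y => F p.1 p.2) :
    Continuous fun x => UniformOnFun.ofFun {K : Set Y | IsCompact K} (F x) := by
  rw [continuous_iff_continuousAt]
  intro x
  rw [ContinuousAt, UniformOnFun.tendsto_iff_tendstoUniformlyOn]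
  exact fun K hK => tendstoUniformlyOn_of_continuous_uncurry h tendsto_id hK

theorem contDiff_nestedW_param {n : ℕ} (w : List Bool) :
    ContDiff ℝ ∞ fun p : (Bilin n × E n) × E n => nestedW p.1.1 p.1.2 p.2 w := by
  induction w with
  | nil => exact contDiff_const
  | cons b w ih =>
    have hb : ContDiff ℝ ∞ fun p : (Bilin n × E n) × E n => cond b p.1.2 p.2 := by
      cases b
      · exact contDiff_snd
      · exact contDiff_snd.comp contDiff_fst
    cases w with
    | nil => exact hb
    | cons c w => exact ((contDiff_fst.comp contDiff_fst).clm_apply hb).clm_apply ih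

theorem contDiff_dL_param {n : ℕ} : ContDiff ℝ ∞ fun p : Bilin n × E n => dL p.1 p.2 := by
  have h : ContDiff ℝ ∞ fun p : (Bilin n × E n) × E n => bchMul p.1.1 p.1.2 p.2 := by
    unfold bchMul bchTerm
    refine ContDiff.sum fun d _ => ContDiff.sum fun m _ => ContDiff.sum fun ρ _ => ?_
    apply ContDiff.const_smul
    obtain ⟨w, -, hw⟩ := dynkinWord_eq (n := n) ρ
    simp only [hw]
    exact contDiff_nestedW_param w
  exact ContDiff.fderiv (n := ∞) h contDiff_const (by simp)

/-- The coefficients of `g_μ`, for arbitrary bilinear maps `μ`. -/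
def nilForm {n : ℕ} (μ : Bilin n) (x : E n) : E n →L[ℝ] E n →L[ℝ] ℝ :=
  ((innerSL ℝ).comp (dL μ x).inverse).flip.comp (dL μ x).inverse

/-- Operator inversion is smooth at invertible operators. Smoothness is stated pointwise in the
ambient space of bilinear maps, because `nilVariety n` is only a closed subset and `dL` is known to
be invertible only over it. -/
theorem contDiffAt_nilForm {n : ℕ} (μ : nilVariety n) (x : E n) :
    ContDiffAt ℝ ∞ (fun p : Bilin n × E n => nilForm p.1 p.2) (μ.1.1, x) := by
  have h : ContDiffAt ℝ ∞ (fun p : Bilin n × E n => (dL p.1 p.2).inverse) (μ.1.1, x) := by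
    obtain ⟨e, he⟩ := exists_equiv_dL μ x
    have h1 : ContDiffAt ℝ ∞ ContinuousLinearMap.inverse (dL μ.1.1 x) := by
      rw [← he]
      exact contDiffAt_map_inverse e
    exact ContDiffAt.comp (μ.1.1, x) (g := ContinuousLinearMap.inverse) h1
      contDiff_dL_param.contDiffAt
  have h1 : ContDiffAt ℝ ∞
      (fun p : Bilin n × E n => (innerSL ℝ : E n →L[ℝ] E n →L[ℝ] ℝ).comp (dL p.1 p.2).inverse)
      (μ.1.1, x) := contDiffAt_const.clm_comp h
  exact ((ContinuousLinearMap.flipₗᵢ ℝ (E n) (E n) ℝ).contDiff.contDiffAt.comp _ h1).clm_comp h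

/-- A function on `V_n × ℝⁿ` that is smooth near `N_n × ℝⁿ` gives a continuous family of functions
on `ℝⁿ`, parametrized by `N_n`. -/
theorem continuous_uncurry_nilVariety {n : ℕ} {W : Type*} [TopologicalSpace W]
    {F : Bilin n → E n → W}
    (hF : ∀ (μ : nilVariety n) (x : E n),
      ContinuousAt (fun p : Bilin n × E n => F p.1 p.2) (μ.1.1, x)) :
    Continuous fun p : nilVariety n × E n => F p.1.1.1 p.2 := by
  rw [continuous_iff_continuousAt]
  intro p
  have h : Continuous fun p : nilVariety n × E n => ((p.1.1.1, p.2) : Bilin n × E n) := by fun_prop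
  exact ContinuousAt.comp (f := fun p : nilVariety n × E n => ((p.1.1.1, p.2) : Bilin n × E n))
    (g := fun p : Bilin n × E n => F p.1 p.2) (hF p.1 p.2) h.continuousAt

theorem continuous_nilMetric {n : ℕ} : Continuous (nilMetric : nilVariety n → Metric n) := by
  refine continuous_induced_rng.mpr (continuous_pi fun q => ?_)
  have h := continuous_uncurry_nilVariety
    (F := fun (μ : Bilin n) (x : E n) => iteratedFDeriv ℝ q (nilForm μ) x)
    fun μ x => ((contDiffAt_nilForm μ x).iteratedFDeriv_snd q).continuousAt
  exact continuous_ofFun_of_uncurry h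

/-! ### Covariant derivatives of families of tensors -/

theorem contDiff_mat {n : ℕ} (g : Metric n) (i j : Fin n) : ContDiff ℝ ∞ fun x => g.mat x i j :=
  (g.smooth.clm_apply contDiff_const).clm_apply contDiff_const

/-- A kernel vector of the Gram matrix would be a nonzero vector of length zero. -/
theorem det_mat_ne_zero {n : ℕ} (g : Metric n) (x : E n) : (g.mat x).det ≠ 0 := by
  intro h
  obtain ⟨v, hv, h0⟩ := Matrix.exists_mulVec_eq_zero_iff.mpr h
  have hw : WithLp.toLp 2 v ≠ 0 := fun h => hv (by simpa using congrArg WithLp.ofLp h)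
  refine (g.pos x _ hw).ne' ?_
  rw [← sum_smul_basisVec (WithLp.toLp 2 v)]
  simp only [map_sum, map_smul, sum_apply, smul_apply, smul_eq_mul]
  have h1 : ∀ i, ∑ j, g.inner x (basisVec i) (basisVec j) * v j = 0 := fun i => congrFun h0 i
  calc _ = ∑ i, v i * ∑ j, g.inner x (basisVec i) (basisVec j) * v j := by
        simp only [Finset.mul_sum]
        rw [Finset.sum_comm]
        refine Finset.sum_congr rfl fun i _ => Finset.sum_congr rfl fun j _ => ?_
        ring
    _ = 0 := by simp [h1]

theorem contDiff_det {V ι : Type*} [NormedAddCommGroup V] [NormedSpace ℝ V] [Fintype ι]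
    [DecidableEq ι] {A : V → Matrix ι ι ℝ} (hA : ∀ i j, ContDiff ℝ ∞ fun x => A x i j) :
    ContDiff ℝ ∞ fun x => (A x).det := by
  simp only [Matrix.det_apply']
  exact ContDiff.sum fun σ _ => contDiff_const.mul (contDiff_prod fun i _ => hA _ _)

theorem contDiff_mat_inv {n : ℕ} (g : Metric n) (i j : Fin n) :
    ContDiff ℝ ∞ fun x => (g.mat x)⁻¹ i j := by
  simp only [Matrix.inv_def, Ring.inverse_eq_inv', Matrix.smul_apply, smul_eq_mul,
    Matrix.adjugate_apply]
  refine ((contDiff_det (contDiff_mat g)).inv (det_mat_ne_zero g)).mul (contDiff_det fun a b => ?_)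
  by_cases h : a = j
  · subst h
    simp only [Matrix.updateRow_self]
    exact contDiff_const
  · simp only [Matrix.updateRow_ne h]
    exact contDiff_mat g a b

theorem contDiff_pderiv {n : ℕ} (i : Fin n) {f : E n → ℝ} (hf : ContDiff ℝ ∞ f) :
    ContDiff ℝ ∞ (pderiv i f) :=
  (hf.fderiv_right (by simp)).clm_apply contDiff_const

theorem contDiff_christoffel {n : ℕ} (g : Metric n) (i j k : Fin n) :
    ContDiff ℝ ∞ (g.christoffel i j k) := by
  unfold Metric.christoffel
  exact contDiff_const.mul (ContDiff.sum fun l _ => (contDiff_mat_inv g k l).mul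
    (((contDiff_pderiv i (contDiff_mat g j l)).add (contDiff_pderiv j (contDiff_mat g i l))).sub
      (contDiff_pderiv l (contDiff_mat g i j))))

/-- Families of tensor fields on `ℝⁿ` with parameters in `V_n`, smooth near `N_n × ℝⁿ`. -/
def SmoothFamily {n m : ℕ} (T : Bilin n → Tensor n m) : Prop :=
  ∀ (μ : nilVariety n) (x : E n) (I : Fin m → Fin n),
    ContDiffAt ℝ ∞ (fun p : Bilin n × E n => T p.1 I p.2) (μ.1.1, x)

theorem SmoothFamily.covDeriv {n m : ℕ} {T : Bilin n → Tensor n m} (hT : SmoothFamily T)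
    (g : Metric n) : SmoothFamily fun μ => g.covDeriv (T μ) := by
  intro μ x I
  unfold Metric.covDeriv
  refine ContDiffAt.sub ?_ (ContDiffAt.sum fun s _ => ContDiffAt.sum fun k _ =>
    ((contDiff_christoffel g _ _ _).comp contDiff_snd).contDiffAt.mul (hT μ x _))
  exact ((hT μ x (Fin.tail I)).fderiv_snd
    (F := fun (μ : Bilin n) (x : E n) => T μ (Fin.tail I) x)).clm_apply contDiffAt_const

theorem SmoothFamily.iterCovDeriv {n m : ℕ} {T : Bilin n → Tensor n m} (hT : SmoothFamily T)
    (g : Metric n) : ∀ q : ℕ, SmoothFamily fun μ => g.iterCovDeriv (T μ) q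
  | 0 => hT
  | q + 1 => (hT.iterCovDeriv g q).covDeriv g

theorem SmoothFamily.continuous_tensorNorm {n m : ℕ} {T : Bilin n → Tensor n m}
    (hT : SmoothFamily T) (g : Metric n) :
    Continuous fun p : nilVariety n × E n => g.tensorNorm (T p.1.1.1) p.2 := by
  have h : ∀ I, Continuous fun p : nilVariety n × E n => T p.1.1.1 I p.2 := fun I =>
    continuous_uncurry_nilVariety (F := fun (μ : Bilin n) (x : E n) => T μ I x)
      fun μ x => (hT μ x I).continuousAt
  unfold Metric.tensorNorm
  refine Real.continuous_sqrt.comp (continuous_finsetSum _ fun I _ => continuous_finsetSum _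
    fun J _ => ((continuous_finsetProd _ fun s _ => ?_).mul (h I)).mul (h J))
  exact (contDiff_mat_inv g (I s) (J s)).continuous.comp continuous_snd

theorem covDeriv_zero {n m : ℕ} (g : Metric n) : g.covDeriv (0 : Tensor n m) = 0 := by
  ext I x
  have h : pderiv (I 0) 0 x = 0 := by
    rw [pderiv, fderiv_zero]
    rfl
  simp [Metric.covDeriv, h]

theorem iterCovDeriv_zero {n m : ℕ} (g : Metric n) : ∀ q, g.iterCovDeriv (0 : Tensor n m) q = 0
  | 0 => rfl
  | q + 1 => by rw [Metric.iterCovDeriv, iterCovDeriv_zero g q, covDeriv_zero]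

theorem tensorNorm_zero {n m : ℕ} (g : Metric n) (x : E n) :
    g.tensorNorm (0 : Tensor n m) x = 0 := by
  simp [Metric.tensorNorm]

/-- With the connection of `g_l` fixed, `‖∇^q (g_μ - g_l)‖` is jointly continuous in `(μ, x)` and
vanishes identically at `μ = l`, so it tends to zero uniformly on compact sets. -/
theorem convSmooth_nilMetric {n : ℕ} {μ : ℕ → nilVariety n} {l : nilVariety n}
    (h : Tendsto μ atTop (𝓝 l)) :
    ConvSmooth 0 (fun k => nilMetric (μ k)) (nilMetric l) := by
  set g := nilMetric l with hg
  let T : Bilin n → Tensor n 2 := fun μ I x =>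
    nilForm μ x (basisVec (I 0)) (basisVec (I 1)) - g.mat x (I 0) (I 1)
  have hT : SmoothFamily T := fun μ x I =>
    (((contDiffAt_nilForm μ x).clm_apply contDiffAt_const).clm_apply contDiffAt_const).sub
      ((contDiff_mat g _ _).comp contDiff_snd).contDiffAt
  have hTl : T l.1.1 = 0 := by
    ext I x
    exact sub_self _
  have key : ∀ (K : Set (E n)), IsCompact K → ∀ ε > 0, ∀ q : ℕ, ∀ᶠ k in atTop, ∀ x ∈ K,
      g.tensorNorm (g.iterCovDeriv ((nilMetric (μ k)).diff g) q) x < ε := by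
    intro K hK ε hε q
    have hc := (hT.iterCovDeriv g q).continuous_tensorNorm g
    have h1 := tendstoUniformlyOn_of_continuous_uncurry
      (F := fun ν : nilVariety n => g.tensorNorm (g.iterCovDeriv (T ν.1.1) q)) hc h hK
    filter_upwards [Metric.tendstoUniformlyOn_iff.mp h1 ε hε] with k hk x hx
    have h2 := hk x hx
    rw [hTl, iterCovDeriv_zero, tensorNorm_zero, dist_zero_left] at h2
    exact (le_abs_self _).trans_lt h2
  intro K hK p _ ε hε
  have h1 := (Set.finite_Iic p).eventually_all.mpr fun q _ => key K hK ε hε q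
  obtain ⟨k₀, hk₀⟩ := eventually_atTop.mp h1
  exact ⟨k₀, fun k hk q _ hq x hx => hk₀ k hk q hq x hx⟩

/-! ### Recovering the bracket from the first derivatives of the metric at the origin -/

/-- The first derivatives at the origin of the coefficients of a metric. -/
def Metric.firstJet {n : ℕ} (g : Metric n) (i j l : Fin n) : ℝ :=
  fderiv ℝ g.inner 0 (basisVec i) (basisVec j) (basisVec l)

theorem continuous_fderiv_of_continuous_ofFun {X V W : Type*} [TopologicalSpace X]
    [NormedAddCommGroup V] [NormedSpace ℝ V] [NormedAddCommGroup W] [NormedSpace ℝ W]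
    {F : X → V → W} (h : Continuous fun a (q : ℕ) =>
      UniformOnFun.ofFun {K : Set V | IsCompact K} (iteratedFDeriv ℝ q (F a))) (x v : V) :
    Continuous fun a => fderiv ℝ (F a) x v := by
  have h1 : Continuous fun a => iteratedFDeriv ℝ 1 (F a) x :=
    (UniformOnFun.uniformContinuous_eval_of_mem (V [×1]→L[ℝ] W)
      {K : Set V | IsCompact K} (Set.mem_singleton x) isCompact_singleton).continuous.comp
      (continuous_pi_iff.mp h 1)
  have h2 : Continuous fun a => iteratedFDeriv ℝ 1 (F a) x fun _ => v :=
    (ContinuousMultilinearMap.apply ℝ (fun _ : Fin 1 => V) W fun _ => v).continuous.comp h1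
  simpa only [iteratedFDeriv_one_apply] using h2

theorem continuous_firstJet {n : ℕ} :
    Continuous (Metric.firstJet : Metric n → Fin n → Fin n → Fin n → ℝ) := by
  refine continuous_pi fun i => continuous_pi fun j => continuous_pi fun l => ?_
  have h1 : Continuous fun g : Metric n => fderiv ℝ g.inner 0 (basisVec i) :=
    continuous_fderiv_of_continuous_ofFun (F := fun g : Metric n => g.inner)
      continuous_induced_dom 0 (basisVec i)
  exact (h1.clm_apply continuous_const).clm_apply continuous_const

theorem firstJet_nilMetric {n : ℕ} (μ : nilVariety n) :
    (nilMetric μ).firstJet = (-(1 / 2) : ℝ) • symStructureConst μ.1.1 := by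
  ext i j l
  exact fderiv_nilMetric_zero μ _ _ _

theorem isEmbedding_firstJet_nilMetric {n : ℕ} :
    IsEmbedding fun μ : nilVariety n => (nilMetric μ).firstJet := by
  simp only [firstJet_nilMetric]
  exact (Homeomorph.smulOfNeZero (-(1 / 2) : ℝ) (by norm_num)).isEmbedding.comp
    isClosedEmbedding_symStructureConst.isEmbedding

/-- The first jet is a continuous function of the metric, and composing with it already yields an
embedding. -/
theorem isEmbedding_nilMetric {n : ℕ} : IsEmbedding (nilMetric : nilVariety n → Metric n) :=
  IsEmbedding.of_comp continuous_nilMetric continuous_firstJet isEmbedding_firstJet_nilMetric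

theorem hasFDerivAt_mat {n : ℕ} (g : Metric n) (j l : Fin n) :
    HasFDerivAt (fun x => g.mat x j l)
      (((fderiv ℝ g.inner 0).flip (basisVec j)).flip (basisVec l)) 0 := by
  have h : HasFDerivAt g.inner (fderiv ℝ g.inner 0) 0 :=
    (g.smooth.differentiable (by simp) 0).hasFDerivAt
  have h1 := (h.clm_apply (hasFDerivAt_const (basisVec j) 0)).clm_apply
    (hasFDerivAt_const (basisVec l) 0)
  exact h1.congr_fderiv (by ext1 v; simp)

theorem mat_nilMetric_zero {n : ℕ} (μ : nilVariety n) : (nilMetric μ).mat 0 = 1 := by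
  ext i j
  simp [Metric.mat, nilMetric_zero, basisVec, EuclideanSpace.inner_single_right, Matrix.one_apply,
    eq_comm]

/-- Where the Gram matrix is the identity, the tensor norm is the Euclidean norm of the components.
-/
theorem abs_le_tensorNorm {n m : ℕ} (g : Metric n) (x : E n) (hg : g.mat x = 1) (T : Tensor n m)
    (I : Fin m → Fin n) : |T I x| ≤ g.tensorNorm T x := by
  have h : ∀ I J : Fin m → Fin n,
      (∏ s, (g.mat x)⁻¹ (I s) (J s)) * T I x * T J x = if I = J then T I x ^ 2 else 0 := by
    intro I J
    rw [hg, inv_one]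
    split_ifs with hIJ
    · subst hIJ
      simp [sq]
    · obtain ⟨s, hs⟩ := Function.ne_iff.mp hIJ
      have hprod : ∏ s, (1 : Matrix (Fin n) (Fin n) ℝ) (I s) (J s) = 0 :=
        Finset.prod_eq_zero (Finset.mem_univ s) (Matrix.one_apply_ne hs)
      rw [hprod, zero_mul, zero_mul]
  unfold Metric.tensorNorm
  simp only [h, Finset.sum_ite_eq, Finset.mem_univ, if_true]
  refine Real.abs_le_sqrt ?_
  exact Finset.single_le_sum (f := fun I => T I x ^ 2) (fun _ _ => sq_nonneg _) (Finset.mem_univ I)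

/-- Both metrics agree at the origin, so the Christoffel terms multiply zero and only the partial
derivative remains. -/
theorem covDeriv_diff_nilMetric_zero {n : ℕ} (μ l : nilVariety n) (i j k : Fin n) :
    (nilMetric l).covDeriv ((nilMetric μ).diff (nilMetric l)) (Fin.cons i ![j, k]) 0
      = (nilMetric μ).firstJet i j k - (nilMetric l).firstJet i j k := by
  have h0 : ∀ I, (nilMetric μ).diff (nilMetric l) I 0 = 0 := fun I => by
    rw [Metric.diff, mat_nilMetric_zero, mat_nilMetric_zero, sub_self]
  have h1 : HasFDerivAt ((nilMetric μ).diff (nilMetric l) ![j, k]) _ 0 :=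
    (hasFDerivAt_mat (nilMetric μ) j k).sub (hasFDerivAt_mat (nilMetric l) j k)
  rw [Metric.covDeriv]
  simp only [h0, mul_zero, Finset.sum_const_zero, sub_zero, Fin.cons_zero, Fin.tail_cons]
  rw [pderiv, h1.fderiv]
  rfl

/-- Control of the first covariant derivatives at the origin suffices for convergence of the
brackets. -/
theorem tendsto_of_convSmooth_one {n : ℕ} {μ : ℕ → nilVariety n} {l : nilVariety n}
    (h : ConvSmooth 1 (fun k => nilMetric (μ k)) (nilMetric l)) : Tendsto μ atTop (𝓝 l) := by
  rw [isEmbedding_firstJet_nilMetric.isInducing.tendsto_nhds_iff]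
  refine tendsto_pi_nhds.mpr fun i => tendsto_pi_nhds.mpr fun j => tendsto_pi_nhds.mpr fun m => ?_
  refine Metric.tendsto_atTop.mpr fun ε hε => ?_
  -- The single point `0` and the single order `q = 1` are all that is used of the hypothesis.
  obtain ⟨k₀, hk₀⟩ := h {0} isCompact_singleton 1 one_pos ε hε
  refine ⟨k₀, fun k hk => ?_⟩
  have h1 := hk₀ k hk 1 le_rfl le_rfl 0 rfl
  refine lt_of_le_of_lt ?_ h1
  have h2 := abs_le_tensorNorm (nilMetric l) 0 (mat_nilMetric_zero l)
    ((nilMetric l).covDeriv ((nilMetric (μ k)).diff (nilMetric l))) (Fin.cons i ![j, m])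
  rw [covDeriv_diff_nilMetric_zero] at h2
  exact h2

theorem ConvSmooth.mono {n q₀ q₁ : ℕ} (hq : q₀ ≤ q₁) {gs : ℕ → Metric n} {g : Metric n}
    (h : ConvSmooth q₀ gs g) : ConvSmooth q₁ gs g := by
  intro K hK p hp ε hε
  obtain ⟨k₀, hk₀⟩ := h K hK p hp ε hε
  exact ⟨k₀, fun k hk q h1 => hk₀ k hk q (hq.trans h1)⟩

end Nilmanifold

end

theorem mainTheorem6 (n : ℕ) :
    (∀ (μ : ℕ → Nilmanifold.nilVariety n) (l : Nilmanifold.nilVariety n),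
      (Tendsto (fun k => (μ k : Nilmanifold.skewBilin n)) atTop
          (𝓝 (l : Nilmanifold.skewBilin n)) ↔
        Nilmanifold.ConvSmooth 0 (fun k => Nilmanifold.nilMetric (μ k))
          (Nilmanifold.nilMetric l)) ∧
      (Tendsto (fun k => (μ k : Nilmanifold.skewBilin n)) atTop
          (𝓝 (l : Nilmanifold.skewBilin n)) ↔
        Nilmanifold.ConvSmooth 1 (fun k => Nilmanifold.nilMetric (μ k))
          (Nilmanifold.nilMetric l)) ∧
      (Tendsto (fun k => (μ k : Nilmanifold.skewBilin n)) atTop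
          (𝓝 (l : Nilmanifold.skewBilin n)) ↔
        Tendsto (fun k => Nilmanifold.nilMetric (μ k)) atTop
          (𝓝 (Nilmanifold.nilMetric l)))) ∧
    IsEmbedding (fun μ : Nilmanifold.nilVariety n => Nilmanifold.nilMetric μ) := by
  refine ⟨fun μ l => ?_, Nilmanifold.isEmbedding_nilMetric⟩
  have hval : Tendsto (fun k => (μ k : Nilmanifold.skewBilin n)) atTop
      (𝓝 (l : Nilmanifold.skewBilin n)) ↔ Tendsto μ atTop (𝓝 l) := tendsto_subtype_rng.symm
  rw [hval]
  exact ⟨⟨Nilmanifold.convSmooth_nilMetric,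
      fun h => Nilmanifold.tendsto_of_convSmooth_one (h.mono zero_le_one)⟩,
    ⟨fun h => (Nilmanifold.convSmooth_nilMetric h).mono zero_le_one,
      Nilmanifold.tendsto_of_convSmooth_one⟩,
    Nilmanifold.isEmbedding_nilMetric.isInducing.tendsto_nhds_iff⟩
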